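/- Let $d\ge 0$ and let $D=(D_{jk})$ be an antisymmetric real $d\times d$ matrix. Let $\mathcal A_D$ be the noncommutative torus of $D$, that is, the universal $\mathrm C^*$-algebra generated by unitaries $U_1,\dots,U_d$ satisfying $$U_jU_k=e^{-2\pi i D_{jk}}U_kU_j\qquad (j,k=1,\dots,d),$$ and for $x=(x_1,\dots,x_d)\in\mathbb Z^d$ put $U_x:=U_1^{x_1}U_2^{x_2}\cdots U_d^{x_d}$. Let $$H:=\{x\in\mathbb Z^d \mid \langle x, Dy\rangle\in\mathbb Z \text{ for all } y\in\mathbb Z^d\}$$ and let $m:=\operatorname{rank}H$ be the degeneracy index of $D$. Then the centre $\mathrm Z(\mathcal A_D)$ is isomorphic, as a $\mathrm C^*$-algebra, to $C(\mathbb T^m)$. More precisely, let $\{p_1,\dots,p_d\}$ be a basis of $\mathbb Z^d$ and let $a_1,\dots,a_m$ be positive integers with $a_i\mid a_{i+1}$ for $1\le i<m$ such that $\{a_1p_1,\dots,a_mp_m\}$ is a basis of $H$. Then there is a $*$-isomorphism $C(\mathbb T^m)\cong \mathrm Z(\mathcal A_D)$ that sends $z_j$ to $U_{p_j}^{a_j}$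 for $j=1,\dots,m$, where $z_j\colon\mathbb T^m\to\mathbb T\subset\mathbb C$ is the projection onto the $j$-th coordinate. -/

import Mathlib

noncomputable section

namespace NCTorus

open UniformSpace

/-! ### The group \*-algebra of the free group

`ℂ[F_d]`, with `star g = g⁻¹` for `g ∈ F_d`, is the universal unital complex \*-algebra generated by
`d` unitaries. -/

/-- The involution of `ℂ[F_d]`: the conjugate-linear map with `g ↦ g⁻¹` on group elements. -/
def freeStar {d : ℕ} :
    MonoidAlgebra ℂ (FreeGroup (Fin d)) →+ MonoidAlgebra ℂ (FreeGroup (Fin d)) where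
  toFun x := MonoidAlgebra.ofCoeff
    (Finsupp.mapDomain (fun g => g⁻¹) (Finsupp.mapRange (star : ℂ → ℂ) (star_zero ℂ) x.coeff))
  map_zero' := by simp
  map_add' x y := by
    simp [Finsupp.mapRange_add, Finsupp.mapDomain_add]

theorem freeStar_single {d : ℕ} (g : FreeGroup (Fin d)) (c : ℂ) :
    freeStar (MonoidAlgebra.single g c) = MonoidAlgebra.single g⁻¹ (star c) := by
  simp [freeStar, Finsupp.mapDomain_single]

/-- The \*-algebra of noncommutative Laurent polynomials in `d` unitaries, that is `ℂ[F_d]`, as a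
type that remembers the matrix `D` (on which its seminorm will depend). -/
def Pre {d : ℕ} (_D : Matrix (Fin d) (Fin d) ℝ) : Type :=
  MonoidAlgebra ℂ (FreeGroup (Fin d))

variable {d : ℕ} (D : Matrix (Fin d) (Fin d) ℝ)

instance : Ring (Pre D) := inferInstanceAs (Ring (MonoidAlgebra ℂ (FreeGroup (Fin d))))

instance : Algebra ℂ (Pre D) :=
  inferInstanceAs (Algebra ℂ (MonoidAlgebra ℂ (FreeGroup (Fin d))))

/-- The group element `g` as an element of `ℂ[F_d]`. -/
def Pre.of : FreeGroup (Fin d) →* Pre D := MonoidAlgebra.of ℂ (FreeGroup (Fin d))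

theorem Pre.induction {motive : Pre D → Prop} (x : Pre D)
    (add : ∀ x y, motive x → motive y → motive (x + y))
    (smul_of : ∀ (c : ℂ) g, motive (c • Pre.of D g)) : motive x := by
  refine MonoidAlgebra.induction_linear (motive := motive) x ?_ add ?_
  · have h := smul_of 0 1
    rw [zero_smul] at h
    exact h
  · intro g c
    have h := smul_of c g
    have e : (c • Pre.of D g : Pre D) = (MonoidAlgebra.single g c : MonoidAlgebra ℂ _) := by
      change c • (MonoidAlgebra.of ℂ (FreeGroup (Fin d)) g) = _
      simp
    rw [e] at h
    exact h

instance : Star (Pre D) := ⟨fun x => freeStar (d := d) x⟩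

theorem Pre.star_add' (x y : Pre D) : star (x + y) = star x + star y :=
  map_add (freeStar (d := d)) x y

theorem Pre.star_smul_of (c : ℂ) (g : FreeGroup (Fin d)) :
    star (c • Pre.of D g) = star c • Pre.of D g⁻¹ := by
  change freeStar (c • (MonoidAlgebra.of ℂ (FreeGroup (Fin d)) g)) =
    star c • (MonoidAlgebra.of ℂ (FreeGroup (Fin d)) g⁻¹)
  simp [freeStar_single]

instance : StarRing (Pre D) where
  star_involutive x := by
    induction x using Pre.induction with
    | add x y hx hy => rw [Pre.star_add', Pre.star_add', hx, hy]
    | smul_of c g => simp [Pre.star_smul_of]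
  star_mul x y := by
    induction x using Pre.induction with
    | add x x' hx hx' => rw [add_mul, Pre.star_add', Pre.star_add', hx, hx', mul_add]
    | smul_of c g =>
      induction y using Pre.induction with
      | add y y' hy hy' => rw [mul_add, Pre.star_add', Pre.star_add', hy, hy', add_mul]
      | smul_of c' g' =>
        rw [smul_mul_smul_comm, ← map_mul, Pre.star_smul_of, Pre.star_smul_of, Pre.star_smul_of,
          smul_mul_smul_comm, ← map_mul, mul_inv_rev, star_mul]
  star_add := Pre.star_add' D

instance : StarModule ℂ (Pre D) where
  star_smul c x := by
    induction x using Pre.induction with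
    | add x y hx hy => rw [smul_add, star_add, hx, hy, star_add, smul_add]
    | smul_of c' g => rw [smul_smul, Pre.star_smul_of, Pre.star_smul_of, smul_smul, star_mul']

/-! ### The universal C\*-seminorm -/

/-- A C\*-seminorm on `ℂ[F_d]` that vanishes on the relations
`u_j u_k = exp(-2πi D_{jk}) u_k u_j`. -/
structure IsAdmissible (p : Seminorm ℂ (Pre D)) : Prop where
  map_mul_le : ∀ x y, p (x * y) ≤ p x * p y
  map_star_mul_self : ∀ x, p (star x * x) = p x * p x
  rel : ∀ j k, p (Pre.of D (.of j) * Pre.of D (.of k) -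
    Complex.exp (-2 * Real.pi * Complex.I * D j k) •
      (Pre.of D (.of k) * Pre.of D (.of j))) = 0

variable {D} in
theorem IsAdmissible.map_of_le {p : Seminorm ℂ (Pre D)} (hp : IsAdmissible D p)
    (g : FreeGroup (Fin d)) : p (Pre.of D g) ≤ 1 := by
  have h1 : p 1 ≤ 1 := by
    have h := hp.map_star_mul_self 1
    rw [star_one, one_mul] at h
    nlinarith [apply_nonneg p 1]
  have h := hp.map_star_mul_self (Pre.of D g)
  have e : star (Pre.of D g) * Pre.of D g = 1 := by
    have := Pre.star_smul_of D 1 g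
    rw [one_smul, star_one, one_smul] at this
    rw [this, ← map_mul, inv_mul_cancel, map_one]
  rw [e] at h
  nlinarith [apply_nonneg p (Pre.of D g)]

theorem exists_bound (x : Pre D) : ∃ C, ∀ p, IsAdmissible D p → p x ≤ C := by
  induction x using Pre.induction with
  | add x y hx hy =>
    obtain ⟨C, hC⟩ := hx
    obtain ⟨C', hC'⟩ := hy
    exact ⟨C + C', fun p hp => (map_add_le_add p x y).trans (add_le_add (hC p hp) (hC' p hp))⟩
  | smul_of c g =>
    refine ⟨‖c‖ * 1, fun p hp => ?_⟩
    rw [map_smul_eq_mul]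
    exact mul_le_mul_of_nonneg_left (hp.map_of_le g) (norm_nonneg c)

theorem isAdmissible_zero : IsAdmissible D 0 where
  map_mul_le x y := by simp
  map_star_mul_self x := by simp
  rel j k := by simp

/-- The largest C\*-seminorm on `ℂ[F_d]` that vanishes on the relations. -/
def univNorm (x : Pre D) : ℝ := ⨆ p : {p : Seminorm ℂ (Pre D) // IsAdmissible D p}, p.1 x

instance : Nonempty {p : Seminorm ℂ (Pre D) // IsAdmissible D p} := ⟨⟨0, isAdmissible_zero D⟩⟩

theorem bddAbove_range (x : Pre D) :
    BddAbove (Set.range fun p : {p : Seminorm ℂ (Pre D) // IsAdmissible D p} => p.1 x) := by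
  obtain ⟨C, hC⟩ := exists_bound D x
  exact ⟨C, by rintro _ ⟨p, rfl⟩; exact hC p.1 p.2⟩

variable {D} in
theorem IsAdmissible.le_univNorm {p : Seminorm ℂ (Pre D)} (hp : IsAdmissible D p) (x : Pre D) :
    p x ≤ univNorm D x :=
  le_ciSup (bddAbove_range D x) (⟨p, hp⟩ : {p : Seminorm ℂ (Pre D) // IsAdmissible D p})

theorem univNorm_nonneg (x : Pre D) : 0 ≤ univNorm D x :=
  (isAdmissible_zero D).le_univNorm x

/-- The largest admissible seminorm, as a seminorm. -/
def univSeminorm : Seminorm ℂ (Pre D) :=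
  Seminorm.of (univNorm D)
    (fun x y => ciSup_le fun p => (map_add_le_add p.1 x y).trans
      (add_le_add (p.2.le_univNorm x) (p.2.le_univNorm y)))
    (fun c x => by
      simp only [univNorm, map_smul_eq_mul]
      rw [Real.mul_iSup_of_nonneg (norm_nonneg c)])

theorem isAdmissible_univSeminorm : IsAdmissible D (univSeminorm D) where
  map_mul_le x y := ciSup_le fun p => (p.2.map_mul_le x y).trans
    (mul_le_mul (p.2.le_univNorm x) (p.2.le_univNorm y) (apply_nonneg _ _) (univNorm_nonneg D x))
  map_star_mul_self x := by
    change univNorm D (star x * x) = univNorm D x * univNorm D x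
    apply le_antisymm
    · refine ciSup_le fun p => ?_
      rw [p.2.map_star_mul_self]
      exact mul_self_le_mul_self (apply_nonneg _ _) (p.2.le_univNorm x)
    · have h : univNorm D x ≤ √(univNorm D (star x * x)) := ciSup_le fun p => by
        apply Real.le_sqrt_of_sq_le
        rw [sq, ← p.2.map_star_mul_self]
        exact p.2.le_univNorm _
      calc univNorm D x * univNorm D x ≤ √(univNorm D (star x * x)) * √(univNorm D (star x * x)) :=
            mul_self_le_mul_self (univNorm_nonneg D x) h
        _ = univNorm D (star x * x) := Real.mul_self_sqrt (univNorm_nonneg D _)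
  rel j k := by
    apply le_antisymm _ (apply_nonneg _ _)
    exact ciSup_le fun p => (p.2.rel j k).le

instance : SeminormedRing (Pre D) :=
  { (univSeminorm D).toAddGroupSeminorm.toSeminormedAddCommGroup, (inferInstance : Ring (Pre D)) with
    norm_mul_le := (isAdmissible_univSeminorm D).map_mul_le }

instance : NormedAlgebra ℂ (Pre D) where
  norm_smul_le c x := (map_smul_eq_mul (univSeminorm D) c x).le

theorem Pre.norm_star_mul_self (x : Pre D) : ‖star x * x‖ = ‖x‖ * ‖x‖ :=
  (isAdmissible_univSeminorm D).map_star_mul_self x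

theorem Pre.norm_star_le (x : Pre D) : ‖star x‖ ≤ ‖x‖ := by
  have h := Pre.norm_star_mul_self D (star x)
  rw [star_star] at h
  have h2 := norm_mul_le x (star x)
  by_contra hlt
  push Not at hlt
  nlinarith [norm_nonneg x]

instance : NormedStarGroup (Pre D) where
  norm_star_le := Pre.norm_star_le D

/-! ### The noncommutative torus -/

/-- The underlying type of the noncommutative torus `𝒜_D`, the universal C\*-algebra generated by
unitaries `U_1, …, U_d` with `U_j U_k = exp(-2πi D_{jk}) U_k U_j`: the separated completion of the
universal \*-algebra `ℂ[F_d]` generated by `d` unitaries, for the largest C\*-seminorm that vanishes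
on the relations. -/
def _root_.NCTorus : Type := Completion (Pre D)

instance : NormedRing (NCTorus D) := inferInstanceAs (NormedRing (Completion (Pre D)))

instance : Algebra ℂ (NCTorus D) := inferInstanceAs (Algebra ℂ (Completion (Pre D)))

instance : NormedAlgebra ℂ (NCTorus D) where
  norm_smul_le c x := norm_smul_le (β := Completion (Pre D)) c x

instance : CompleteSpace (NCTorus D) := inferInstanceAs (CompleteSpace (Completion (Pre D)))

/-- The canonical map from noncommutative Laurent polynomials to `𝒜_D`. -/
def toTorus : Pre D →ₐ[ℂ] NCTorus D where
  toFun x := (x : Completion (Pre D))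
  map_one' := Completion.coe_one _
  map_mul' := Completion.coe_mul
  map_zero' := Completion.coe_zero
  map_add' := Completion.coe_add
  commutes' _ := rfl

theorem norm_toTorus (x : Pre D) : ‖toTorus D x‖ = ‖x‖ := Completion.norm_coe x

theorem continuous_toTorus : Continuous (toTorus D) := Completion.continuous_coe _

theorem denseRange_toTorus : DenseRange (toTorus D) := Completion.denseRange_coe

theorem isUniformInducing_toTorus : IsUniformInducing (toTorus D) :=
  Completion.isUniformInducing_coe _

instance : Star (NCTorus D) := ⟨(Completion.map (star : Pre D → Pre D) : Completion (Pre D) → _)⟩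

theorem continuous_star_torus : Continuous (star : NCTorus D → NCTorus D) :=
  Completion.continuous_map

theorem star_toTorus (x : Pre D) : star (toTorus D x) = toTorus D (star x) :=
  Completion.map_coe
    (AddMonoidHomClass.uniformContinuous_of_bound (starAddEquiv : Pre D ≃+ Pre D) 1
      (fun x => by simp)) x

instance : StarRing (NCTorus D) where
  star_involutive x := by
    have hc := continuous_star_torus D
    refine (denseRange_toTorus D).induction_on x (isClosed_eq (by fun_prop) (by fun_prop)) ?_
    intro x
    simp [star_toTorus]
  star_mul x y := by
    have hc := continuous_star_torus D
    refine (denseRange_toTorus D).induction_on₂ (isClosed_eq (by fun_prop) (by fun_prop)) ?_ x y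
    intro x y
    simp [star_toTorus, ← map_mul]
  star_add x y := by
    have hc := continuous_star_torus D
    refine (denseRange_toTorus D).induction_on₂ (isClosed_eq (by fun_prop) (by fun_prop)) ?_ x y
    intro x y
    simp [star_toTorus, ← map_add]

instance : CStarRing (NCTorus D) where
  norm_mul_self_le x := by
    have hc := continuous_star_torus D
    refine (denseRange_toTorus D).induction_on x (isClosed_le (by fun_prop) (by fun_prop)) ?_
    intro x
    rw [star_toTorus, ← map_mul, norm_toTorus, norm_toTorus, Pre.norm_star_mul_self]

instance : StarModule ℂ (NCTorus D) where
  star_smul c x := by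
    have hc := continuous_star_torus D
    refine (denseRange_toTorus D).induction_on x
      (isClosed_eq (hc.comp (continuous_const_smul c)) (hc.const_smul (star c))) ?_
    intro x
    rw [← map_smul (toTorus D) c x, star_toTorus, star_toTorus, star_smul, map_smul (toTorus D)]

instance : CStarAlgebra (NCTorus D) where

/-- The canonical unitary generator `U_j` of `𝒜_D`. -/
def U (j : Fin d) : unitary (NCTorus D) :=
  ⟨toTorus D (Pre.of D (.of j)), by
    have e : star (Pre.of D (.of j)) = Pre.of D (FreeGroup.of j)⁻¹ := by
      have := Pre.star_smul_of D 1 (.of j)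
      rwa [one_smul, star_one, one_smul] at this
    rw [Unitary.mem_iff, star_toTorus, e, ← map_mul, ← map_mul, ← map_mul, ← map_mul]
    simp⟩

/-- The product `U_x = U_1^{x_1} U_2^{x_2} ⋯ U_d^{x_d}`, for `x ∈ ℤ^d`. -/
def UProd (x : Fin d → ℤ) : unitary (NCTorus D) := (List.ofFn fun j => U D j ^ x j).prod

theorem U_mul_U (j k : Fin d) : (U D j * U D k : NCTorus D) =
    Complex.exp (-2 * Real.pi * Complex.I * D j k) • (U D k * U D j : NCTorus D) := by
  rw [← sub_eq_zero, ← norm_eq_zero]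
  have h : (U D j * U D k : NCTorus D) -
      Complex.exp (-2 * Real.pi * Complex.I * D j k) • (U D k * U D j : NCTorus D) =
      toTorus D (Pre.of D (.of j) * Pre.of D (.of k) -
        Complex.exp (-2 * Real.pi * Complex.I * D j k) •
          (Pre.of D (.of k) * Pre.of D (.of j))) := by
    rw [map_sub (toTorus D), map_smul (toTorus D), map_mul (toTorus D), map_mul (toTorus D)]
    rfl
  rw [h, norm_toTorus]
  exact (isAdmissible_univSeminorm D).rel j k

/-- The universal property of `𝒜_D`. -/
theorem existsUnique_lift {B : Type*} [CStarAlgebra B] (V : Fin d → unitary B)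
    (hV : ∀ j k, (V j * V k : B) =
      Complex.exp (-2 * Real.pi * Complex.I * D j k) • (V k * V j : B)) :
    ∃! φ : NCTorus D →⋆ₐ[ℂ] B, ∀ j, φ (U D j) = V j := by
  let w : FreeGroup (Fin d) →* B := (unitary B).subtype.comp (FreeGroup.lift V)
  let f : Pre D →ₐ[ℂ] B := MonoidAlgebra.lift ℂ B (FreeGroup (Fin d)) w
  have hf (g) : f (Pre.of D g) = w g := MonoidAlgebra.lift_of _ _
  have hfs (x : Pre D) : f (star x) = star (f x) := by
    induction x using Pre.induction with
    | add x y hx hy => simp only [star_add, map_add, hx, hy]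
    | smul_of c g =>
      have e : w g⁻¹ = star (w g) := by
        simp only [w, MonoidHom.comp_apply, map_inv]
        rfl
      rw [Pre.star_smul_of, map_smul, map_smul, star_smul, hf, hf, e]
  let p : Seminorm ℂ (Pre D) := (normSeminorm ℂ B).comp f.toLinearMap
  have hp : IsAdmissible D p :=
    { map_mul_le := fun x y => by simpa [p] using norm_mul_le (f x) (f y)
      map_star_mul_self := fun x => by simp [p, hfs, CStarRing.norm_star_mul_self]
      rel := fun j k => by simp [p, hf, w, hV j k] }
  have hfb (x : Pre D) : ‖f x‖ ≤ ‖x‖ := hp.le_univNorm x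
  have hfc : Continuous f := AddMonoidHomClass.continuous_of_bound f 1 (by simpa using hfb)
  let F : NCTorus D →+* B := Completion.extensionHom (f : Pre D →+* B) hfc
  have hF (x : Pre D) : F (toTorus D x) = f x := Completion.extensionHom_coe _ hfc x
  have hFc : Continuous F := Completion.continuous_extension
  have hst := continuous_star_torus D
  refine ⟨{ F with
    commutes' := fun c => ?_
    map_star' := fun x => ?_ }, fun j => ?_, fun ψ hψ => ?_⟩
  · have : algebraMap ℂ (NCTorus D) c = toTorus D (algebraMap ℂ _ c) := by simp
    change F _ = _
    rw [this, hF]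
    simp
  · change F _ = star (F _)
    refine (denseRange_toTorus D).induction_on x (isClosed_eq (by fun_prop) (by fun_prop)) ?_
    intro x
    rw [star_toTorus, hF, hF, hfs]
  · change F (toTorus D _) = _
    rw [hF, hf]
    simp [w]
  · have hψc : Continuous ψ := 
      AddMonoidHomClass.continuous_of_bound ψ 1
        (by simpa only [one_mul] using NonUnitalStarAlgHom.norm_apply_le ψ)
    ext x
    change ψ x = F x
    refine (denseRange_toTorus D).induction_on x (isClosed_eq hψc hFc) ?_
    intro x
    rw [hF]
    let g : FreeGroup (Fin d) →* B :=
      ((ψ : NCTorus D →ₐ[ℂ] B).comp (toTorus D) : Pre D →* B).comp (Pre.of D)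
    have hg : g = w := by
      apply FreeGroup.ext_hom
      intro j
      have e : w (.of j) = V j := by simp [w]
      exact (hψ j).trans e.symm
    induction x using Pre.induction with
    | add x y hx hy => simp only [map_add, hx, hy]
    | smul_of c h =>
      rw [map_smul, map_smul, map_smul, hf, ← hg]
      rfl

/-! ### Centre and degeneracy index -/

/-- The centre of a complex \*-algebra, as a \*-subalgebra. -/
def starCenter (A : Type*) [Ring A] [StarRing A] [Algebra ℂ A] [StarModule ℂ A] :
    StarSubalgebra ℂ A :=
  { Subalgebra.center ℂ A with
    star_mem' := fun h => Set.star_mem_center h }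

/-- The subgroup `H = {x ∈ ℤ^d | ⟨x, D y⟩ ∈ ℤ for all y ∈ ℤ^d}` of `ℤ^d`. -/
def H : Submodule ℤ (Fin d → ℤ) where
  carrier := {x | ∀ y : Fin d → ℤ, ∃ n : ℤ,
    (fun i => (x i : ℝ)) ⬝ᵥ D.mulVec (fun i => (y i : ℝ)) = n}
  zero_mem' y := ⟨0, by simp [dotProduct]⟩
  add_mem' {x x'} hx hx' y := by
    obtain ⟨n, hn⟩ := hx y
    obtain ⟨n', hn'⟩ := hx' y
    refine ⟨n + n', ?_⟩
    rw [Int.cast_add, ← hn, ← hn', ← add_dotProduct]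
    congr 1
    ext i
    simp
  smul_mem' c x hx y := by
    obtain ⟨n, hn⟩ := hx y
    refine ⟨c * n, ?_⟩
    rw [Int.cast_mul, ← hn, ← smul_eq_mul, ← smul_dotProduct]
    congr 1
    ext i
    simp

/-- The degeneracy index of `D`: the rank of the free abelian group `H`. -/
def degeneracyIndex : ℕ := Module.finrank ℤ (H D)

theorem degeneracyIndex_le : degeneracyIndex D ≤ d := by
  have h := Submodule.finrank_le (H D)
  rwa [Module.finrank_fin_fun] at h

/-- `p` is a basis of `ℤ^d` and `a_1 ∣ a_2 ∣ ⋯ ∣ a_m` are positive integers, `m` the degeneracy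
index of `D`, such that `a_1 p_1, …, a_m p_m` is a basis of `H`. -/
structure IsAdaptedBasis (p : Module.Basis (Fin d) ℤ (Fin d → ℤ))
    (a : Fin (degeneracyIndex D) → ℕ) : Prop where
  pos : ∀ i, 0 < a i
  dvd : ∀ i j, i ≤ j → a i ∣ a j
  linearIndependent :
    LinearIndependent ℤ fun i => (a i : ℤ) • p (Fin.castLE (degeneracyIndex_le D) i)
  span_eq :
    Submodule.span ℤ (Set.range fun i => (a i : ℤ) • p (Fin.castLE (degeneracyIndex_le D) i)) = H D

/-- The coordinate function `z_j` on the torus `𝕋^m`. -/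
def coordFun {m : ℕ} (j : Fin m) : C(Fin m → Circle, ℂ) := ⟨fun z => (z j : ℂ), by fun_prop⟩

end NCTorus

end

noncomputable section

namespace NCTorus

open Filter Topology WeakDual

variable {d : ℕ} (D : Matrix (Fin d) (Fin d) ℝ)

/-! Modulo scalars the generators commute, so `x ↦ U_x` is a homomorphism from `ℤ^d` to unitaries
modulo scalars, and the monomials span a dense subspace. Conjugation by `U_j` multiplies `U_x` by
`exp(-2πi (Dx)_j)`; all these factors are 1 exactly when `x ∈ H`, so such monomials are central.
Conversely, averaging over conjugation by powers of `U_j` is contractive, fixes central elements and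
in the limit kills the monomials not commuting with `U_j`. Doing this for every `j` shows that the
`U_x` with `x ∈ H` span a dense subspace of the centre (`mem_closure_span_H`).

The rest is Gelfand duality. A character of the centre is determined by its values on the monomials
of a basis of `H` (`character_ext`). The gauge automorphisms `U_j ↦ z_j U_j` move one character to
any prescribed point of the torus (`exists_gauge_character`, `exists_gauge_parameter`), and one
exists because `𝒜_D ≠ 0` (`nontrivial_of_antisymm`). Hence the spectrum is `𝕋^m`; linear
independence of the monomials is never needed. -/

theorem prod_ofFn_mul_of_commute {M : Type*} [Monoid M] {n : ℕ} (f g : Fin n → M)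
    (h : ∀ i j, Commute (f i) (g j)) :
    (List.ofFn fun i => f i * g i).prod = (List.ofFn f).prod * (List.ofFn g).prod := by
  induction n with
  | zero => simp
  | succ n ih =>
    have hc : Commute (g 0) (List.ofFn fun i : Fin n => f i.succ).prod := by
      refine Commute.list_prod_right _ _ fun x hx => ?_
      obtain ⟨i, rfl⟩ := (List.mem_ofFn' _ _).1 hx
      exact (h i.succ 0).symm
    rw [List.ofFn_succ, List.ofFn_succ, List.ofFn_succ, List.prod_cons, List.prod_cons,
      List.prod_cons, ih _ _ fun i j => h i.succ j.succ, mul_assoc (f 0), mul_assoc (f 0),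
      ← mul_assoc (g 0), hc.eq, mul_assoc]

/-! ### Scalars -/

/-- The scalar unitaries of a complex \*-algebra. -/
def scalar (A : Type*) [Ring A] [StarRing A] [Algebra ℂ A] [StarModule ℂ A] :
    Circle →* unitary A where
  toFun z := ⟨algebraMap ℂ A z, by
    rw [Unitary.mem_iff, ← algebraMap_star_comm, ← map_mul, ← map_mul, mul_comm (z : ℂ), and_self]
    have : star (z : ℂ) * z = 1 := by
      rw [Complex.star_def, mul_comm, Complex.mul_conj, Circle.normSq_coe, Complex.ofReal_one]
    rw [this, map_one]⟩
  map_one' := by ext; simp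
  map_mul' z w := by ext; simp

section scalar

variable {A : Type*} [Ring A] [StarRing A] [Algebra ℂ A] [StarModule ℂ A]

theorem scalar_mul_coe (z : Circle) (u : unitary A) :
    ((scalar A z * u : unitary A) : A) = (z : ℂ) • (u : A) := by
  rw [Algebra.smul_def]
  rfl

theorem scalar_commute (z : Circle) (u : unitary A) : Commute (scalar A z) u := by
  ext
  exact Algebra.commutes (z : ℂ) (u : A)

instance : (scalar A).range.Normal where
  conj_mem := by
    rintro _ ⟨z, rfl⟩ g
    rw [← (scalar_commute z g).eq, mul_inv_cancel_right]
    exact ⟨z, rfl⟩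

theorem mk_eq_mk_iff (u v : unitary A) :
    (u : unitary A ⧸ (scalar A).range) = v ↔ ∃ z, v = scalar A z * u := by
  rw [QuotientGroup.eq]
  constructor
  · rintro ⟨z, hz⟩
    exact ⟨z, by rw [(scalar_commute z u).eq, hz, mul_inv_cancel_left]⟩
  · rintro ⟨z, rfl⟩
    exact ⟨z, by rw [(scalar_commute z u).eq]; group⟩

end scalar

/-- The scalar `exp(-2πi t)`. -/
def phase (t : ℝ) : Circle := Circle.exp (-2 * Real.pi * t)

theorem coe_phase (t : ℝ) : (phase t : ℂ) = Complex.exp (-2 * Real.pi * Complex.I * t) := by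
  rw [phase, Circle.coe_exp]
  push_cast
  congr 1
  ring

theorem phase_add (s t : ℝ) : phase (s + t) = phase s * phase t := by
  rw [phase, mul_add, Circle.exp_add]
  rfl

theorem phase_zero : phase 0 = 1 := by simp [phase]

/-- `phase` as a homomorphism. -/
def phaseHom : Multiplicative ℝ →* Circle where
  toFun t := phase t.toAdd
  map_one' := phase_zero
  map_mul' s t := phase_add s.toAdd t.toAdd

theorem phase_neg (t : ℝ) : phase (-t) = (phase t)⁻¹ := map_inv phaseHom (.ofAdd t)

theorem phase_mul_int (t : ℝ) (n : ℤ) : phase (t * n) = phase t ^ n := by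
  have := map_zpow phaseHom (.ofAdd t) n
  rw [← ofAdd_zsmul, zsmul_eq_mul, mul_comm] at this
  exact this

theorem phase_sum {ι : Type*} (s : Finset ι) (t : ι → ℝ) :
    phase (∑ i ∈ s, t i) = ∏ i ∈ s, phase (t i) := by
  have := map_prod phaseHom (fun i => .ofAdd (t i)) s
  rw [← ofAdd_sum] at this
  exact this

theorem phase_eq_one_iff (t : ℝ) : phase t = 1 ↔ ∃ n : ℤ, t = n := by
  rw [phase, Circle.exp_eq_one]
  have hp := Real.pi_ne_zero
  constructor
  · rintro ⟨n, hn⟩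
    refine ⟨-n, ?_⟩
    have : -2 * Real.pi * (t + n) = 0 := by linarith
    push_cast
    rcases mul_eq_zero.1 this with h | h
    · simp [hp] at h
    · linarith
  · rintro ⟨n, rfl⟩
    exact ⟨-n, by push_cast; ring⟩

theorem exists_phase_eq (z : Circle) : ∃ t, phase t = z := by
  refine ⟨-(Complex.arg z / (2 * Real.pi)), ?_⟩
  rw [phase]
  have hp := Real.pi_ne_zero
  have : -2 * Real.pi * -(Complex.arg z / (2 * Real.pi)) = Complex.arg z := by field_simp
  rw [this, Circle.exp_arg]

/-! ### Monomials up to scalars -/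

theorem U_mul_U' (j k : Fin d) :
    U D j * U D k = scalar _ (phase (D j k)) * (U D k * U D j) := by
  ext
  rw [scalar_mul_coe, coe_phase]
  exact U_mul_U D j k

theorem UProd_single (j : Fin d) : UProd D (Pi.single j 1) = U D j := by
  rw [UProd]
  -- The length and the family are generalised so that induction can pass to the tail of the
  -- product.
  have h : ∀ (n : ℕ) (j : Fin n) (v : Fin n → unitary (NCTorus D)),
      (List.ofFn fun k => v k ^ (Pi.single j 1 : Fin n → ℤ) k).prod = v j := by
    intro n
    induction n with
    | zero => exact fun j => j.elim0
    | succ n ih =>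
      intro j v
      rw [List.ofFn_succ, List.prod_cons]
      induction j using Fin.cases with
      | zero => simp
      | succ j =>
        have e : ∀ k : Fin n, (Pi.single j.succ 1 : Fin (n + 1) → ℤ) k.succ =
            (Pi.single j 1 : Fin n → ℤ) k := by
          intro k
          simp [Pi.single_apply]
        simp only [e]
        rw [ih j fun k => v k.succ]
        simp [(Fin.succ_ne_zero _).symm]
  exact h d j (U D)

/-- The monomials modulo scalars, as a homomorphism. -/
def monomialClass :
    Multiplicative (Fin d → ℤ) →* unitary (NCTorus D) ⧸ (scalar (NCTorus D)).range :=
  MonoidHom.mk' (fun x => (UProd D x.toAdd : unitary (NCTorus D) ⧸ (scalar (NCTorus D)).range))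
    fun x y => by
      have hmk (x : Fin d → ℤ) : QuotientGroup.mk' (scalar (NCTorus D)).range (UProd D x) =
          (List.ofFn fun j => QuotientGroup.mk' (scalar (NCTorus D)).range (U D j) ^ x j).prod := by
        rw [UProd, map_list_prod, List.map_ofFn]
        rfl
      have hc (i j) : Commute (QuotientGroup.mk' (scalar (NCTorus D)).range (U D i))
          (QuotientGroup.mk' (scalar (NCTorus D)).range (U D j)) := by
        rw [Commute, SemiconjBy, ← map_mul, ← map_mul]
        exact (mk_eq_mk_iff _ _).2 ⟨_, U_mul_U' D j i⟩
      change QuotientGroup.mk' _ _ = QuotientGroup.mk' _ _ * QuotientGroup.mk' _ _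
      rw [hmk, hmk, hmk, ← prod_ofFn_mul_of_commute _ _ fun i j =>
        ((hc i j).zpow_left _).zpow_right _]
      congr 2
      ext j
      rw [← zpow_add]
      rfl

theorem monomialClass_ofAdd (x : Fin d → ℤ) :
    monomialClass D (.ofAdd x) = (UProd D x : unitary (NCTorus D) ⧸ (scalar (NCTorus D)).range) :=
  rfl

/-- The unitary of `𝒜_D` given by a word in the generators. -/
def word : FreeGroup (Fin d) →* unitary (NCTorus D) := FreeGroup.lift (U D)

theorem coe_word (g : FreeGroup (Fin d)) : (word D g : NCTorus D) = toTorus D (Pre.of D g) := by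
  have : (unitary (NCTorus D)).subtype.comp (word D) =
      ((toTorus D : Pre D →* NCTorus D).comp (Pre.of D)) := by
    apply FreeGroup.ext_hom
    intro j
    simp [word]
    rfl
  exact DFunLike.congr_fun this g

/-- Modulo scalars, both sides are homomorphisms out of the free group, so agreement on generators
suffices; `x` is the vector of exponent sums of `g`. -/
theorem exists_word_eq (g : FreeGroup (Fin d)) :
    ∃ z x, word D g = scalar (NCTorus D) z * UProd D x := by
  let deg : FreeGroup (Fin d) →* Multiplicative (Fin d → ℤ) :=
    FreeGroup.lift fun j => .ofAdd (Pi.single j 1)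
  have h : (QuotientGroup.mk' (scalar (NCTorus D)).range).comp (word D) =
      (monomialClass D).comp deg := by
    apply FreeGroup.ext_hom
    intro j
    simp only [MonoidHom.comp_apply, word, deg, FreeGroup.lift_apply_of, monomialClass_ofAdd,
      UProd_single]
    rfl
  obtain ⟨z, hz⟩ := (mk_eq_mk_iff _ _).1 (DFunLike.congr_fun h g).symm
  exact ⟨z, _, hz⟩

theorem dense_span_UProd :
    Dense (Submodule.span ℂ (Set.range fun x => (UProd D x : NCTorus D)) : Set (NCTorus D)) := by
  refine (denseRange_toTorus D).mono ?_
  rintro _ ⟨x, rfl⟩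
  induction x using Pre.induction with
  | add x y hx hy =>
    rw [map_add]
    exact Submodule.add_mem _ hx hy
  | smul_of c g =>
    rw [map_smul, ← coe_word]
    obtain ⟨z, x, hx⟩ := exists_word_eq D g
    rw [hx, scalar_mul_coe]
    exact Submodule.smul_mem _ _ (Submodule.smul_mem _ _ (Submodule.subset_span ⟨x, rfl⟩))

/-! ### Diagonal automorphisms -/

/-- Scalars are central, so they can be pulled out of the ordered product. This serves both
conjugation by `U_j` and the gauge automorphisms. -/
theorem map_UProd_of_map_U (φ : unitary (NCTorus D) →* unitary (NCTorus D)) (z : Fin d → Circle)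
    (h : ∀ j, φ (U D j) = scalar _ (z j) * U D j) (x : Fin d → ℤ) :
    φ (UProd D x) = scalar _ (∏ j, z j ^ x j) * UProd D x := by
  rw [UProd, map_list_prod, List.map_ofFn, ← List.prod_ofFn, map_list_prod, List.map_ofFn,
    ← prod_ofFn_mul_of_commute (scalar _ ∘ fun j => z j ^ x j) _ fun i j => scalar_commute _ _]
  congr 2
  ext j
  have hc : Commute (scalar (NCTorus D) (z j)) (U D j) := scalar_commute _ _
  simp only [Function.comp_apply, map_zpow, h, hc.mul_zpow]

theorem mem_center_of_commute_U {b : NCTorus D}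
    (h : ∀ j, Commute (U D j : NCTorus D) b) : b ∈ starCenter (NCTorus D) := by
  have hg (g) : Commute (word D g : NCTorus D) b := by
    induction g using FreeGroup.induction_on with
    | C1 => simp
    | of j => simpa [word] using h j
    | inv_of j _ =>
      rw [map_inv]
      have e : word D (FreeGroup.of j) = U D j := by simp [word]
      rw [e]
      have := h j
      calc ((U D j)⁻¹ : unitary (NCTorus D)) * b
        _ = ((U D j)⁻¹ : unitary (NCTorus D)) * (b * U D j) * ((U D j)⁻¹ : unitary _) := by
            rw [mul_assoc, mul_assoc, ← Submonoid.coe_mul, mul_inv_cancel]; simp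
        _ = _ := by
            rw [← (h j).eq, ← mul_assoc, ← Submonoid.coe_mul, inv_mul_cancel]; simp
    | mul x y hx hy =>
      rw [map_mul]
      exact hx.mul_left hy
  refine Subalgebra.mem_center_iff.2 fun a => ?_
  refine (denseRange_toTorus D).induction_on a (isClosed_eq (by fun_prop) (by fun_prop)) fun x => ?_
  induction x using Pre.induction with
  | add x y hx hy => rw [map_add, add_mul, mul_add, hx, hy]
  | smul_of c g =>
    rw [map_smul, ← coe_word, smul_mul_assoc, (hg g).eq, mul_smul_comm]

theorem U_conj_UProd (j : Fin d) (x : Fin d → ℤ) :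
    U D j * UProd D x * (U D j)⁻¹ = scalar _ (phase (∑ k, D j k * x k)) * UProd D x := by
  have := map_UProd_of_map_U D (MulAut.conj (U D j)).toMonoidHom (fun k => phase (D j k))
    (fun k => by
      change U D j * U D k * (U D j)⁻¹ = _
      rw [U_mul_U', mul_assoc, mul_inv_cancel_right]) x
  simp only [MulEquiv.toMonoidHom_eq_coe, MonoidHom.coe_coe, MulAut.conj_apply] at this
  rw [this, phase_sum]
  simp only [phase_mul_int]

/-- The gauge automorphism `U_j ↦ z_j U_j`. -/
theorem exists_gauge (z : Fin d → Circle) :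
    ∃ γ : NCTorus D →⋆ₐ[ℂ] NCTorus D,
      ∀ x, γ (UProd D x) = ((∏ j, z j ^ x j : Circle) : ℂ) • (UProd D x : NCTorus D) := by
  obtain ⟨γ, hγ, -⟩ := existsUnique_lift D (fun j => scalar _ (z j) * U D j) fun j k => by
    rw [scalar_mul_coe, scalar_mul_coe, smul_mul_smul_comm, smul_mul_smul_comm, U_mul_U,
      smul_comm, mul_comm (z j : ℂ)]
  refine ⟨γ, fun x => ?_⟩
  have := map_UProd_of_map_U D (Unitary.map
    ({ (γ : NCTorus D →* NCTorus D) with map_star' := map_star γ } :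
      NCTorus D →⋆* NCTorus D)).toMonoidHom z
    (fun j => by ext; exact hγ j) x
  rw [← scalar_mul_coe, ← this]
  rfl

/-! ### The group `H` and the centre -/

variable {D}

/-- Antisymmetry turns `⟨x, Dy⟩` into `-⟨Dx, y⟩`, so the condition says that `Dx` is an integer
vector, which is what the conjugation phases detect. -/
theorem mem_H_iff (hD : D.transpose = -D) (x : Fin d → ℤ) :
    x ∈ H D ↔ ∀ j, phase (∑ k, D j k * x k) = 1 := by
  have key (y : Fin d → ℤ) : (fun i => (x i : ℝ)) ⬝ᵥ D.mulVec (fun i => (y i : ℝ)) =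
      ∑ j, -(∑ k, D j k * x k) * y j := by
    have hD' (j k) : D j k = - D k j := by
      have := congrFun (congrFun hD k) j
      simpa using this
    simp only [dotProduct, Matrix.mulVec, Finset.mul_sum, Finset.sum_mul, neg_mul,
      ← Finset.sum_neg_distrib]
    rw [Finset.sum_comm]
    refine Finset.sum_congr rfl fun j _ => Finset.sum_congr rfl fun k _ => ?_
    rw [hD' j k]
    ring
  change (∀ y : Fin d → ℤ, ∃ n : ℤ, _ = (n : ℝ)) ↔ _
  simp only [key]
  constructor
  · intro h j
    have := (phase_eq_one_iff _).2 (h (Pi.single j 1))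
    rw [phase_sum, Finset.prod_eq_single j (fun k _ hk => by simp [hk, phase_zero]) (by simp)]
      at this
    simpa [phase_neg] using this
  · intro h y
    rw [← phase_eq_one_iff, phase_sum]
    refine Finset.prod_eq_one fun j _ => ?_
    rw [phase_mul_int, phase_neg, h, inv_one, one_zpow]

theorem UProd_mem_center (hD : D.transpose = -D) {x : Fin d → ℤ} (hx : x ∈ H D) :
    (UProd D x : NCTorus D) ∈ starCenter (NCTorus D) := by
  refine mem_center_of_commute_U D fun j => ?_
  have := U_conj_UProd D j x
  rw [(mem_H_iff hD x).1 hx j, map_one, one_mul, mul_inv_eq_iff_eq_mul] at this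
  exact congrArg Subtype.val this

variable (D)

/-! ### Averaging over powers of a unitary -/

/-- The geometric sums are bounded by `2 / ‖ω - 1‖` independently of `N`. -/
theorem tendsto_average_pow {ω : ℂ} (hω : ‖ω‖ = 1) (h1 : ω ≠ 1) :
    Tendsto (fun N : ℕ => ((N + 1 : ℕ) : ℂ)⁻¹ * ∑ n ∈ Finset.range (N + 1), ω ^ n) atTop (𝓝 0) := by
  have hlim : Tendsto (fun N : ℕ => 2 / ‖ω - 1‖ * ((N : ℝ) + 1)⁻¹) atTop (𝓝 0) := by
    simpa using (tendsto_one_div_add_atTop_nhds_zero_nat (𝕜 := ℝ)).const_mul (2 / ‖ω - 1‖)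
  refine squeeze_zero_norm (fun N => ?_) hlim
  rw [geom_sum_eq h1, norm_mul, norm_inv, norm_div, mul_comm, Complex.norm_natCast]
  push_cast
  gcongr
  calc ‖ω ^ (N + 1) - 1‖ ≤ ‖ω ^ (N + 1)‖ + ‖(1 : ℂ)‖ := norm_sub_le _ _
    _ = 2 := by rw [norm_pow, hω, one_pow, norm_one]; norm_num

section average

variable {A : Type*} [CStarAlgebra A]

/-- The mean of `uⁿ b u⁻ⁿ` over `0 ≤ n ≤ N`. -/
def average (u : unitary A) (N : ℕ) : A →ₗ[ℂ] A :=
  ((N + 1 : ℕ) : ℂ)⁻¹ • ∑ n ∈ Finset.range (N + 1),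
    LinearMap.mulLeftRight ℂ (((u ^ n : unitary A) : A), (((u ^ n)⁻¹ : unitary A) : A))

theorem average_apply (u : unitary A) (N : ℕ) (b : A) :
    average u N b = ((N + 1 : ℕ) : ℂ)⁻¹ • ∑ n ∈ Finset.range (N + 1),
      ((u ^ n : unitary A) : A) * b * (((u ^ n)⁻¹ : unitary A) : A) := by
  simp [average, LinearMap.sum_apply]

theorem norm_average_le (u : unitary A) (N : ℕ) (b : A) : ‖average u N b‖ ≤ ‖b‖ := by
  rw [average_apply, norm_smul, norm_inv, Complex.norm_natCast, inv_mul_le_iff₀ (by positivity)]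
  refine (norm_sum_le _ _).trans ?_
  refine (Finset.sum_le_card_nsmul _ _ ‖b‖ fun n _ => ?_).trans (by simp)
  rw [CStarRing.norm_mul_coe_unitary, CStarRing.norm_coe_unitary_mul]

theorem average_of_commute {u : unitary A} {b : A} (h : Commute (u : A) b) (N : ℕ) :
    average u N b = b := by
  have (n : ℕ) : ((u ^ n : unitary A) : A) * b * (((u ^ n)⁻¹ : unitary A) : A) = b := by
    rw [SubmonoidClass.coe_pow, (h.pow_left n).eq, mul_assoc, ← SubmonoidClass.coe_pow,
      ← Submonoid.coe_mul, mul_inv_cancel, OneMemClass.coe_one, mul_one]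
  rw [average_apply, Finset.sum_congr rfl fun n _ => this n, Finset.sum_const, Finset.card_range,
    ← Nat.cast_smul_eq_nsmul ℂ, smul_smul, inv_mul_cancel₀ (Nat.cast_ne_zero.2 N.succ_ne_zero), one_smul]

theorem average_of_conj_eq {u v : unitary A} {z : Circle} (h : u * v * u⁻¹ = scalar A z * v)
    (N : ℕ) : average u N (v : A) =
      (((N + 1 : ℕ) : ℂ)⁻¹ * ∑ n ∈ Finset.range (N + 1), (z : ℂ) ^ n) • (v : A) := by
  have hn (n : ℕ) : u ^ n * v * (u ^ n)⁻¹ = scalar A (z ^ n) * v := by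
    induction n with
    | zero => simp
    | succ n ih =>
      calc u ^ (n + 1) * v * (u ^ (n + 1))⁻¹ = u * (u ^ n * v * (u ^ n)⁻¹) * u⁻¹ := by group
        _ = u * scalar A (z ^ n) * v * u⁻¹ := by rw [ih]; group
        _ = scalar A (z ^ n) * (u * v * u⁻¹) := by rw [← (scalar_commute _ u).eq]; group
        _ = scalar A (z ^ (n + 1)) * v := by rw [h, pow_succ, map_mul, mul_assoc]
  have hn' (n : ℕ) : ((u ^ n : unitary A) : A) * v * (((u ^ n)⁻¹ : unitary A) : A) =
      (z : ℂ) ^ n • (v : A) := by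
    rw [← Circle.coe_pow, ← scalar_mul_coe, ← hn]
    rfl
  rw [average_apply, Finset.sum_congr rfl fun n _ => hn' n, ← Finset.sum_smul, smul_smul]

end average

/-! ### Density of the monomials in the centre -/

/-- The span of the monomials that commute with `U_j` for `j ∈ J`. -/
def commutingSpan (J : Finset (Fin d)) : Submodule ℂ (NCTorus D) :=
  Submodule.span ℂ ((fun x => (UProd D x : NCTorus D)) ''
    {x | ∀ j ∈ J, phase (∑ k, D j k * x k) = 1})

/-- On a monomial the averages are constant or tend to 0, according to whether it commutes with
`U_i`. The limit is taken only on finite linear combinations, so no conditional expectation has to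
be constructed. -/
theorem exists_tendsto_average {J : Finset (Fin d)} (i : Fin d) {b : NCTorus D}
    (hb : b ∈ commutingSpan D J) : ∃ b' ∈ commutingSpan D (insert i J),
      Tendsto (fun N => average (U D i) N b) atTop (𝓝 b') := by
  induction hb using Submodule.span_induction with
  | mem b hb =>
    obtain ⟨x, hx, rfl⟩ := hb
    by_cases h1 : phase (∑ k, D i k * x k) = 1
    · refine ⟨_, Submodule.subset_span ⟨x, ?_, rfl⟩, ?_⟩
      · intro j hj
        rcases Finset.mem_insert.1 hj with rfl | hj
        exacts [h1, hx j hj]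
      · have hc : Commute (U D i : NCTorus D) (UProd D x) := by
          have := U_conj_UProd D i x
          rw [h1, map_one, one_mul, mul_inv_eq_iff_eq_mul] at this
          exact congrArg Subtype.val this
        simp only [average_of_commute hc]
        exact tendsto_const_nhds
    · refine ⟨0, Submodule.zero_mem _, ?_⟩
      simp only [average_of_conj_eq (U_conj_UProd D i x)]
      simpa using (tendsto_average_pow (Circle.norm_coe _) (by rwa [Ne, Circle.coe_eq_one])).smul_const
        (UProd D x : NCTorus D)
  | zero => exact ⟨0, Submodule.zero_mem _, by simp⟩
  | add x y _ _ hx hy =>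
    obtain ⟨x', hx', hx⟩ := hx
    obtain ⟨y', hy', hy⟩ := hy
    exact ⟨_, Submodule.add_mem _ hx' hy', by simpa using hx.add hy⟩
  | smul c x _ hx =>
    obtain ⟨x', hx', hx⟩ := hx
    exact ⟨_, Submodule.smul_mem _ c hx', by simpa using hx.const_smul c⟩

theorem mem_closure_commutingSpan {a : NCTorus D} (ha : a ∈ starCenter (NCTorus D))
    (J : Finset (Fin d)) : a ∈ closure (commutingSpan D J : Set (NCTorus D)) := by
  induction J using Finset.induction_on with
  | empty =>
    have : commutingSpan D ∅ = Submodule.span ℂ (Set.range fun x => (UProd D x : NCTorus D)) := by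
      simp [commutingSpan]
    rw [this]
    exact dense_span_UProd D a
  | insert i J _ ih =>
    rw [Metric.mem_closure_iff] at ih ⊢
    intro ε hε
    -- Passing to the limit keeps only a weak inequality; `ε / 2` leaves room for the strict one.
    obtain ⟨b, hb, hab⟩ := ih (ε / 2) (half_pos hε)
    obtain ⟨b', hb', hlim⟩ := exists_tendsto_average D i hb
    refine ⟨b', hb', lt_of_le_of_lt ?_ (half_lt_self hε)⟩
    refine le_of_tendsto (tendsto_const_nhds.dist hlim) (Eventually.of_forall fun N => ?_)
    have hc : Commute (U D i : NCTorus D) a := Subalgebra.mem_center_iff.1 ha _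
    -- Since averaging fixes `a` and is contractive, the averages of `b` stay as close to `a` as `b`
    -- was.
    nth_rewrite 1 [← average_of_commute hc N]
    rw [dist_eq_norm, ← map_sub]
    exact (norm_average_le _ _ _).trans ((dist_eq_norm a b).symm.trans_le hab.le)

variable {D} in
theorem mem_closure_span_H (hD : D.transpose = -D) {a : NCTorus D}
    (ha : a ∈ starCenter (NCTorus D)) :
    a ∈ closure (Submodule.span ℂ ((fun x => (UProd D x : NCTorus D)) '' H D) :
      Set (NCTorus D)) := by
  have h := mem_closure_commutingSpan D ha Finset.univ
  have e : {x | ∀ j ∈ Finset.univ, phase (∑ k, D j k * x k) = 1} = (H D : Set (Fin d → ℤ)) := by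
    ext x
    simp [mem_H_iff hD]
  rwa [commutingSpan, e] at h

/-! ### The regular representation -/

/-- The Hilbert basis obtained from `b` by a permutation of the indices and unimodular factors. -/
theorem exists_unitary_basis {ι E : Type*} [NormedAddCommGroup E] [InnerProductSpace ℂ E]
    [CompleteSpace E] (b : HilbertBasis ι ℂ E) (σ : Equiv.Perm ι) (z : ι → Circle) :
    ∃ V : unitary (E →L[ℂ] E), ∀ i, (V : E →L[ℂ] E) (b i) = (z i : ℂ) • b (σ i) := by
  have hon : Orthonormal ℂ fun i => (z i : ℂ) • b (σ i) := by
    refine ⟨fun i => ?_, fun i j hij => ?_⟩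
    · rw [norm_smul, Circle.norm_coe, one_mul, b.orthonormal.1]
    · change inner ℂ ((z i : ℂ) • b (σ i)) ((z j : ℂ) • b (σ j)) = 0
      rw [inner_smul_left, inner_smul_right, b.orthonormal.2 (σ.injective.ne hij), mul_zero,
        mul_zero]
  have hsp : ⊤ ≤ (Submodule.span ℂ (Set.range fun i => (z i : ℂ) • b (σ i))).topologicalClosure := by
    rw [← b.dense_span]
    refine Submodule.topologicalClosure_mono (Submodule.span_le.2 ?_)
    rintro _ ⟨i, rfl⟩
    have : b i = (z (σ.symm i) : ℂ)⁻¹ • ((z (σ.symm i) : ℂ) • b (σ (σ.symm i))) := by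
      rw [smul_smul, inv_mul_cancel₀ (Circle.coe_ne_zero _), one_smul, σ.apply_symm_apply]
    rw [this]
    exact Submodule.smul_mem _ _ (Submodule.subset_span ⟨_, rfl⟩)
  let b' := HilbertBasis.mk hon hsp
  classical
  refine ⟨Unitary.linearIsometryEquiv.symm (b.repr.trans b'.repr.symm), fun i => ?_⟩
  rw [Unitary.coe_symm_linearIsometryEquiv_apply]
  change b'.repr.symm (b.repr (b i)) = _
  rw [b.repr_self, b'.repr_symm_single, HilbertBasis.coe_mk]

variable {D} in
theorem nontrivial_of_antisymm (hD : D.transpose = -D) : Nontrivial (NCTorus D) := by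
  let E := lp (fun _ : Fin d → ℤ => ℂ) 2
  let b : HilbertBasis (Fin d → ℤ) ℂ E := ⟨LinearIsometryEquiv.refl ℂ E⟩
  -- `V_j` is a twisted shift `e_x ↦ phase((Dx)_j / 2) e_{x + e_j}`. Exchanging `V_j` and `V_k`
  -- costs `phase((D_{jk} - D_{kj}) / 2)`, which is `phase(D_{jk})` by antisymmetry; hence the
  -- factor one half.
  choose V hV using fun j => exists_unitary_basis b (Equiv.addRight (Pi.single j 1))
    fun x => phase (2⁻¹ * ∑ k, D j k * x k)
  have hrel (j k) : (V j * V k : E →L[ℂ] E) =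
      Complex.exp (-2 * Real.pi * Complex.I * D j k) • (V k * V j : E →L[ℂ] E) := by
    refine ContinuousLinearMap.ext_on (s := Set.range b) ?_ ?_
    · rw [dense_iff_closure_eq]
      exact congrArg (fun S : Submodule ℂ E => (S : Set E)) b.dense_span
    · rintro _ ⟨x, rfl⟩
      have hD' : D k j = - D j k := by
        simpa using congrFun (congrFun hD j) k
      have hs (i l : Fin d) : ∑ m, D i m * ((x + Pi.single l 1 : Fin d → ℤ) m : ℝ) =
          (∑ m, D i m * x m) + D i l := by
        simp [mul_add, Finset.sum_add_distrib, Pi.single_apply]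
      rw [← coe_phase]
      simp only [mul_apply_eq_comp, smul_apply, hV, map_smul,
        smul_smul, Equiv.coe_addRight, hs]
      rw [add_right_comm, ← Circle.coe_mul, ← Circle.coe_mul, ← Circle.coe_mul, ← phase_add,
        ← phase_add, ← phase_add, hD']
      congr 3
      ring
  obtain ⟨φ, -, -⟩ := existsUnique_lift D V hrel
  have : Nontrivial E := ⟨b 0, 0, b.orthonormal.ne_zero 0⟩
  exact (φ : NCTorus D →+* (E →L[ℂ] E)).domain_nontrivial

/-! ### Gelfand duality for tori -/

theorem norm_character_unitary {Z : Type*} [CommCStarAlgebra Z] (χ : characterSpace ℂ Z)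
    (w : unitary Z) : ‖χ w‖ = 1 := by
  have h : star (χ w) * χ w = 1 := by
    rw [← map_star, ← map_mul, Unitary.coe_star_mul_self, map_one]
  have h2 := CStarRing.norm_star_mul_self (x := χ w)
  rw [h, norm_one] at h2
  nlinarith [norm_nonneg (χ w)]

/-- Evaluation at the `w j` is a continuous bijection from the compact spectrum to the Hausdorff
torus, hence a homeomorphism; compose it with the Gelfand transform. -/
theorem exists_starAlgEquiv_of_characters {Z : Type*} [CommCStarAlgebra Z] {n : ℕ}
    (w : Fin n → unitary Z)
    (hinj : ∀ χ χ' : characterSpace ℂ Z, (∀ j, χ (w j) = χ' (w j)) → χ = χ')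
    (hsurj : ∀ z : Fin n → Circle, ∃ χ : characterSpace ℂ Z, ∀ j, χ (w j) = z j) :
    ∃ φ : C(Fin n → Circle, ℂ) ≃⋆ₐ[ℂ] Z, ∀ j, φ (coordFun j) = w j := by
  let F : characterSpace ℂ Z → Fin n → Circle := fun χ j =>
    ⟨χ (w j), mem_sphere_zero_iff_norm.2 (norm_character_unitary χ (w j))⟩
  have hF (χ j) : (F χ j : ℂ) = χ (w j) := rfl
  have hFc : Continuous F := continuous_pi fun j =>
    Continuous.subtype_mk ((WeakDual.eval_continuous (w j : Z)).comp continuous_subtype_val) _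
  have hFb : Function.Bijective F := by
    refine ⟨fun χ χ' h => hinj _ _ fun j => ?_, fun z => ?_⟩
    · rw [← hF, h, hF]
    · obtain ⟨χ, hχ⟩ := hsurj z
      exact ⟨χ, funext fun j => Circle.ext (hχ j)⟩
  let e : characterSpace ℂ Z ≃ₜ (Fin n → Circle) :=
    Continuous.homeoOfEquivCompactToT2 (f := Equiv.ofBijective F hFb) hFc
  refine ⟨(e.compStarAlgEquiv' ℂ ℂ).trans (gelfandStarTransform Z).symm, fun j => ?_⟩
  rw [StarAlgEquiv.trans_apply, StarAlgEquiv.symm_apply_eq]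
  rfl

/-! ### The centre of the noncommutative torus -/

theorem isClosed_starCenter {A : Type*} [CStarAlgebra A] : IsClosed (starCenter A : Set A) := by
  have : (starCenter A : Set A) = ⋂ b, {a | b * a = a * b} := by
    ext a
    rw [Set.mem_iInter]
    exact Subalgebra.mem_center_iff
  rw [this]
  exact isClosed_iInter fun b => isClosed_eq (by fun_prop) (by fun_prop)

/-- The centre of a C\*-algebra, as a commutative C\*-algebra. -/
abbrev starCenterCStar (A : Type*) [CStarAlgebra A] : CommCStarAlgebra (starCenter A) :=
  { StarSubalgebra.cstarAlgebra (starCenter A) (h_closed := isClosed_starCenter) with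
    mul_comm := fun a b => Subtype.ext (Subalgebra.mem_center_iff.1 b.2 a) }

/-! ### Characters of the centre: separation by monomials and the gauge action -/

theorem exists_UProd_add (x y : Fin d → ℤ) :
    ∃ z, UProd D (x + y) = scalar _ z * (UProd D x * UProd D y) := by
  have := (map_mul (monomialClass D) (.ofAdd x) (.ofAdd y)).symm
  rw [← ofAdd_add] at this
  exact (mk_eq_mk_iff _ _).1 this

theorem exists_UProd_zsmul (c : ℤ) (x : Fin d → ℤ) :
    ∃ z, UProd D (c • x) = scalar _ z * UProd D x ^ c := by
  have := (map_zpow (monomialClass D) (.ofAdd x) c).symm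
  rw [← ofAdd_zsmul] at this
  exact (mk_eq_mk_iff _ _).1 this

theorem UProd_zero : UProd D 0 = 1 := by
  rw [UProd]
  simp

theorem UProd_mem_of_mem_span {S : Subgroup (unitary (NCTorus D))} {s : Set (Fin d → ℤ)}
    (hS : ∀ z, scalar _ z ∈ S) (hs : ∀ x ∈ s, UProd D x ∈ S) {x : Fin d → ℤ}
    (hx : x ∈ Submodule.span ℤ s) : UProd D x ∈ S := by
  induction hx using Submodule.span_induction with
  | mem x hx => exact hs x hx
  | zero => exact UProd_zero D ▸ S.one_mem
  | add x y _ _ hx hy =>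
    obtain ⟨z, hz⟩ := exists_UProd_add D x y
    exact hz ▸ S.mul_mem (hS z) (S.mul_mem hx hy)
  | smul c x _ hx =>
    obtain ⟨z, hz⟩ := exists_UProd_zsmul D c x
    exact hz ▸ S.mul_mem (hS z) (S.zpow_mem hx c)

/-- Unitaries of the centre on which two characters agree. -/
def agreeSubgroup {A : Type*} [CStarAlgebra A] (χ χ' : characterSpace ℂ (starCenter A)) :
    Subgroup (unitary A) where
  carrier := {u | ∃ h : (u : A) ∈ starCenter A, χ ⟨u, h⟩ = χ' ⟨u, h⟩}
  one_mem' := ⟨one_mem _, (map_one χ).trans (map_one χ').symm⟩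
  mul_mem' := by
    rintro u v ⟨hu, hu'⟩ ⟨hv, hv'⟩
    refine ⟨mul_mem hu hv, ?_⟩
    have (ψ : characterSpace ℂ (starCenter A)) :
        ψ ⟨(u * v : unitary A), mul_mem hu hv⟩ = ψ ⟨u, hu⟩ * ψ ⟨v, hv⟩ := map_mul ψ ⟨u, hu⟩ ⟨v, hv⟩
    rw [this, this, hu', hv']
  inv_mem' := by
    -- The C⋆-structure on the centre makes characters preserve `star`, which is inversion on
    -- unitaries.
    let _ := starCenterCStar A
    rintro u ⟨hu, hu'⟩
    refine ⟨star_mem hu, ?_⟩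
    have (ψ : characterSpace ℂ (starCenter A)) :
        ψ ⟨(u⁻¹ : unitary A), star_mem hu⟩ = star (ψ ⟨u, hu⟩) := map_star ψ (⟨u, hu⟩ : starCenter A)
    rw [this, this, hu']

variable {D} in
-- Agreement spreads from `s` to all `U_x` with `x ∈ H`, as the scalars lie in `agreeSubgroup`, then
-- to their linear span, and by continuity to its closure, the whole centre.
theorem character_ext (hD : D.transpose = -D) {χ χ' : characterSpace ℂ (starCenter (NCTorus D))}
    {s : Set (Fin d → ℤ)} (hs : Submodule.span ℤ s = H D)
    (h : ∀ x ∈ s, UProd D x ∈ agreeSubgroup χ χ') : χ = χ' := by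
  have hscal (z : Circle) : scalar _ z ∈ agreeSubgroup χ χ' :=
    ⟨algebraMap_mem _ _, (AlgHomClass.commutes χ (z : ℂ)).trans
      (AlgHomClass.commutes χ' (z : ℂ)).symm⟩
  have hspan (b : NCTorus D) (hb : b ∈ Submodule.span ℂ
      ((fun x => (UProd D x : NCTorus D)) '' H D)) :
      ∃ h : b ∈ starCenter (NCTorus D), χ ⟨b, h⟩ = χ' ⟨b, h⟩ := by
    induction hb using Submodule.span_induction with
    | mem b hb =>
      obtain ⟨x, hx, rfl⟩ := hb
      exact UProd_mem_of_mem_span D hscal h (hs ▸ hx)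
    | zero => exact ⟨zero_mem _, (map_zero χ).trans (map_zero χ').symm⟩
    | add x y _ _ hx hy =>
      obtain ⟨hx, hx'⟩ := hx
      obtain ⟨hy, hy'⟩ := hy
      refine ⟨add_mem hx hy, (map_add χ ⟨x, hx⟩ ⟨y, hy⟩).trans ?_⟩
      rw [hx', hy']
      exact (map_add χ' ⟨x, hx⟩ ⟨y, hy⟩).symm
    | smul c x _ hx =>
      obtain ⟨hx, hx'⟩ := hx
      refine ⟨(starCenter (NCTorus D)).smul_mem hx c, (map_smul χ c ⟨x, hx⟩).trans ?_⟩
      rw [hx']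
      exact (map_smul χ' c ⟨x, hx⟩).symm
  refine CharacterSpace.ext fun a => ?_
  have ha : a ∈ closure {b : starCenter (NCTorus D) | χ b = χ' b} := by
    refine closure_subtype.2 (closure_mono ?_ (mem_closure_span_H hD a.2))
    intro b hb
    obtain ⟨h, h'⟩ := hspan b hb
    exact ⟨⟨b, h⟩, h', rfl⟩
  rwa [(isClosed_eq (map_continuous χ) (map_continuous χ')).closure_eq] at ha

/-- `γ` maps each `U_j` to a nonzero multiple of itself, so applying it to `U_j a = a U_j` and
cancelling suffices; surjectivity of `γ` plays no role. -/
theorem gauge_mem_starCenter {γ : NCTorus D →⋆ₐ[ℂ] NCTorus D} {z : Fin d → Circle}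
    (hγ : ∀ x, γ (UProd D x) = ((∏ j, z j ^ x j : Circle) : ℂ) • (UProd D x : NCTorus D))
    {a : NCTorus D} (ha : a ∈ starCenter (NCTorus D)) : γ a ∈ starCenter (NCTorus D) := by
  refine mem_center_of_commute_U D fun j => ?_
  have hc : UProd D (Pi.single j 1) * a = a * UProd D (Pi.single j 1) :=
    Subalgebra.mem_center_iff.1 ha _
  have := congrArg γ hc
  rw [map_mul, map_mul, hγ, UProd_single, smul_mul_assoc, mul_smul_comm] at this
  exact smul_right_injective _ (Circle.coe_ne_zero _) this

/-- The gauge action on characters of the centre. -/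
theorem exists_gauge_character (z : Fin d → Circle) (χ : characterSpace ℂ (starCenter (NCTorus D))) :
    ∃ χ' : characterSpace ℂ (starCenter (NCTorus D)), ∀ x (h : (UProd D x : NCTorus D) ∈ _),
      χ' ⟨UProd D x, h⟩ = ((∏ j, z j ^ x j : Circle) : ℂ) * χ ⟨UProd D x, h⟩ := by
  let _ := starCenterCStar (NCTorus D)
  obtain ⟨γ, hγ⟩ := exists_gauge D z
  let r : starCenter (NCTorus D) →ₐ[ℂ] starCenter (NCTorus D) :=
    ((γ : NCTorus D →ₐ[ℂ] NCTorus D).comp (starCenter (NCTorus D)).subtype.toAlgHom).codRestrict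
      (starCenter (NCTorus D)).toSubalgebra fun a => gauge_mem_starCenter D hγ a.2
  refine ⟨CharacterSpace.equivAlgHom.symm ((CharacterSpace.equivAlgHom χ).comp r),
    fun x h => ?_⟩
  have hr : r ⟨UProd D x, h⟩ =
      ((∏ j, z j ^ x j : Circle) : ℂ) • (⟨UProd D x, h⟩ : starCenter (NCTorus D)) :=
    Subtype.ext (hγ x)
  rw [CharacterSpace.equivAlgHom_symm_coe, AlgHom.comp_apply, hr]
  exact map_smul χ _ _

theorem exists_gauge_parameter (p : Module.Basis (Fin d) ℤ (Fin d → ℤ)) {n : ℕ} (f : Fin n ↪ Fin d)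
    {a : Fin n → ℤ} (ha : ∀ j, a j ≠ 0) (w : Fin n → Circle) :
    ∃ z : Fin d → Circle, ∀ j, ∏ k, z k ^ (a j • p (f j)) k = w j := by
  choose t ht using fun j => exists_phase_eq (w j)
  -- Lifting from the circle to `ℝ` makes division by `a j` possible. Basis vectors outside the
  -- range of `f` may go anywhere, here to 0.
  let L : (Fin d → ℤ) →ₗ[ℤ] ℝ := p.constr ℤ (Function.extend f (fun j => t j / a j) 0)
  refine ⟨fun k => phase (L fun i => if k = i then 1 else 0), fun j => ?_⟩
  simp only [← phase_mul_int]
  rw [← phase_sum, ← ht]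
  congr 1
  calc _ = L (a j • p (f j)) := by
        rw [LinearMap.pi_apply_eq_sum_univ]
        exact Finset.sum_congr rfl fun k _ => 
          (mul_comm _ _).trans (zsmul_eq_mul _ _).symm
    _ = t j := by
        rw [map_zsmul, Module.Basis.constr_basis, f.injective.extend_apply, zsmul_eq_mul,
          mul_div_cancel₀ _ (Int.cast_ne_zero.2 (ha j))]

variable {D} in
-- No positivity or divisibility of the `a j` is asked, so this covers both a Smith normal form and
-- an adapted basis.
theorem exists_starAlgEquiv_of_basis (hD : D.transpose = -D)
    (p : Module.Basis (Fin d) ℤ (Fin d → ℤ)) {n : ℕ} (f : Fin n ↪ Fin d) {a : Fin n → ℤ}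
    (ha : ∀ j, a j ≠ 0) (hspan : Submodule.span ℤ (Set.range fun j => a j • p (f j)) = H D) :
    ∃ φ : C(Fin n → Circle, ℂ) ≃⋆ₐ[ℂ] starCenter (NCTorus D),
      ∀ j, (φ (coordFun j) : NCTorus D) = (UProd D (p (f j)) ^ a j : unitary (NCTorus D)) := by
  have := nontrivial_of_antisymm hD
  have hmem (j) : a j • p (f j) ∈ H D := hspan ▸ Submodule.subset_span ⟨j, rfl⟩
  choose c hc using fun j => exists_UProd_zsmul D (a j) (p (f j))
  have hW (j) : UProd D (p (f j)) ^ a j = scalar _ (c j)⁻¹ * UProd D (a j • p (f j)) := by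
    rw [hc, ← mul_assoc, ← map_mul, inv_mul_cancel, map_one, one_mul]
  have hWmem (j) : ((UProd D (p (f j)) ^ a j : unitary (NCTorus D)) : NCTorus D) ∈
      starCenter (NCTorus D) := by
    rw [hW]
    exact mul_mem (algebraMap_mem _ _) (UProd_mem_center hD (hmem j))
  let _ := starCenterCStar (NCTorus D)
  let w (j : Fin n) : unitary (starCenter (NCTorus D)) := ⟨⟨_, hWmem j⟩,
    Unitary.mem_iff.2 ⟨Subtype.ext (Unitary.coe_star_mul_self _),
      Subtype.ext (Unitary.coe_mul_star_self _)⟩⟩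
  have hw (j) : (w j : starCenter (NCTorus D)) =
      (((c j)⁻¹ : Circle) : ℂ) • (⟨_, UProd_mem_center hD (hmem j)⟩ : starCenter (NCTorus D)) := by
    ext
    change ((UProd D (p (f j)) ^ a j : unitary (NCTorus D)) : NCTorus D) = _
    rw [hW, scalar_mul_coe]
    rfl
  suffices h : ∃ φ : C(Fin n → Circle, ℂ) ≃⋆ₐ[ℂ] starCenter (NCTorus D),
      ∀ j, φ (coordFun j) = w j by
    obtain ⟨φ, hφ⟩ := h
    exact ⟨φ, fun j => congrArg Subtype.val (hφ j)⟩
  refine exists_starAlgEquiv_of_characters w (fun χ χ' h => ?_) (fun z => ?_)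
  · refine character_ext hD hspan ?_
    rintro _ ⟨j, rfl⟩
    refine ⟨UProd_mem_center hD (hmem j), ?_⟩
    have := h j
    rw [hw, map_smul, map_smul] at this
    exact smul_right_injective _ (Circle.coe_ne_zero _) this
  · have hn : Nontrivial (starCenter (NCTorus D)) := inferInstance
    obtain ⟨χ⟩ : Nonempty (characterSpace ℂ (starCenter (NCTorus D))) := inferInstance
    let v (j : Fin n) : Circle :=
      ⟨χ (w j), mem_sphere_zero_iff_norm.2 (norm_character_unitary χ (w j))⟩
    -- The gauge parameter must multiply the value `v j` of `χ` by `z j / v j`. The scalar `(c j)⁻¹`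
    -- relating `w j` to a monomial is unaffected.
    obtain ⟨t, ht⟩ := exists_gauge_parameter p f ha fun j => z j * (v j)⁻¹
    obtain ⟨χ', hχ'⟩ := exists_gauge_character D t χ
    refine ⟨χ', fun j => ?_⟩
    have hv : (v j : ℂ) = χ (w j) := rfl
    rw [hw, map_smul] at hv
    rw [hw, map_smul, hχ', ht, smul_eq_mul, mul_left_comm, ← smul_eq_mul (_ : ℂ) (χ _), ← hv,
      ← Circle.coe_mul, inv_mul_cancel_right]

end NCTorus

end

theorem mainTheorem4 {d : ℕ} (D : Matrix (Fin d) (Fin d) ℝ) (hD : D.transpose = -D) :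
    Nonempty (C(Fin (NCTorus.degeneracyIndex D) → Circle, ℂ) ≃⋆ₐ[ℂ]
      NCTorus.starCenter (NCTorus D)) ∧
    ∀ (p : Module.Basis (Fin d) ℤ (Fin d → ℤ)) (a : Fin (NCTorus.degeneracyIndex D) → ℕ),
      NCTorus.IsAdaptedBasis D p a →
      ∃ φ : C(Fin (NCTorus.degeneracyIndex D) → Circle, ℂ) ≃⋆ₐ[ℂ]
          NCTorus.starCenter (NCTorus D),
        ∀ j, (φ (NCTorus.coordFun j) : NCTorus D) =
          (NCTorus.UProd D (p (Fin.castLE (NCTorus.degeneracyIndex_le D) j)) : NCTorus D) ^ a j := by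
  constructor
  · obtain ⟨n, s⟩ := (NCTorus.H D).smithNormalForm (Pi.basisFun ℤ (Fin d))
    have hn : NCTorus.degeneracyIndex D = n := Module.finrank_eq_card_basis s.bN |>.trans (by simp)
    have hs : Submodule.span ℤ (Set.range fun j => s.a j • s.bM (s.f j)) = NCTorus.H D := by
      have := congrArg (Submodule.map (NCTorus.H D).subtype) s.bN.span_eq
      rw [Submodule.map_span, Submodule.map_top, Submodule.range_subtype, ← Set.range_comp] at this
      rw [← funext s.snf]
      exact this
    -- A zero coefficient would make a basis vector of `H` vanish.
    have ha (j) : s.a j ≠ 0 := fun h => s.bN.ne_zero j (Subtype.ext (by simp [s.snf, h]))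
    obtain ⟨φ, -⟩ := NCTorus.exists_starAlgEquiv_of_basis hD s.bM s.f ha hs
    exact hn ▸ ⟨φ⟩
  · intro p a h
    obtain ⟨φ, hφ⟩ := NCTorus.exists_starAlgEquiv_of_basis hD p
      (Fin.castLEEmb (NCTorus.degeneracyIndex_le D)) (a := fun j => (a j : ℤ))
      (fun j => Int.natCast_ne_zero.2 (h.pos j).ne') h.span_eq
    exact ⟨φ, fun j => by rw [hφ, zpow_natCast]; rfl⟩
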